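/- All graphs are finite, undirected and without loops. Quantum homomorphisms. A POVM is a finite family of positive semidefinite complex matrices which sums to the identity. Write $X \xrightarrow{q} Y$ (there is a quantum homomorphism from $X$ to $Y$) if there are $d_A, d_B \in \mathbb{N}$, a unit vector $\psi \in \mathbb{C}^{d_A} \otimes \mathbb{C}^{d_B}$ and, for each $x \in V(X)$, POVMs $\{E_{xy}\}_{y \in V(Y)}$ on $\mathbb{C}^{d_A}$ and $\{F_{xy}\}_{y \in V(Y)}$ on $\mathbb{C}^{d_B}$, such that $\psi^*(E_{xy} \otimes F_{xy'})\psi = 0$ whenever $y \neq y'$, and $\psi^*(E_{xy} \otimes F_{x'y'})\psi = 0$ whenever $x \sim x'$ and $y \not\sim y'$. That is, two players sharing $\psi$ win the $(X,Y)$-homomorphism game with probability $1$. Write $X \not\rightarrow Y$ if there is no graph homomorphism from $X$ to $Y$. Homomorphic product. $X \ltimes Y$ is the graph with vertex set $V(X) \times V(Y)$ in which distinct vertices $(x,y)$ and $(x',y')$ are adjacent if $x = x'$, or if $x \sim x'$ and $y \not\sim y'$. Capacities. Let $\mathcal{N}$ be a classical channel with input set $Z$ and conditional output probabilities $\mathcal{N}(w|z)$.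 Its confusability graph has vertex set $Z$, and distinct $z, z'$ are adjacent if some output $w$ has $\mathcal{N}(w|z) > 0$ and $\mathcal{N}(w|z') > 0$. The one-shot zero-error capacity $c_0(\mathcal{N})$ is the largest $m$ such that one of $m$ messages can be sent with zero probability of error by one use of $\mathcal{N}$. The entanglement-assisted one-shot zero-error capacity $c_0^*(\mathcal{N})$ is the largest such $m$ when sender and receiver may also share a finite-dimensional entangled state $\psi$: to send message $i$, Alice measures a POVM $\{E_{iz}\}_{z \in Z}$ on her part of $\psi$ and uses the outcome $z$ as the channel input; on channel output $w$, Bob measures a POVM $\{D^w_j\}_{j \in [m]}$ on his part of $\psi$, and his outcome must equal $i$ with certainty. For a graph $G$, let $c_0(G) = c_0(\mathcal{N})$ and $c_0^*(G) = c_0^*(\mathcal{N})$, where $\mathcal{N}$ is the canonical channel of $G$: on input $v \in V(G)$ it outputs an edge at $v$ uniformly at random, and if $v$ is isolated it outputs a loop at $v$. The confusability graph of this channel is $G$. Statement. If $X \xrightarrow{q} Y$ but $X \not\rightarrow Y$, then \[ c_0(X \ltimes Y) < c_0^*(X \ltimes Y) = |V(X)|. \] Moreover $c_0(\mathcal{N})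 < c_0^*(\mathcal{N}) = |V(X)|$ for every classical channel $\mathcal{N}$ whose confusability graph is $X \ltimes Y$. -/

import Mathlib

namespace QHom

open scoped Kronecker ComplexOrder

/-- A POVM with outcomes in the finite set `O` on the space `ℂ ^ d`: a family of positive
semidefinite matrices which sums to the identity. -/
def IsPOVM {O : Type*} [Fintype O] {d : ℕ} (E : O → Matrix (Fin d) (Fin d) ℂ) : Prop :=
  (∀ o, (E o).PosSemidef) ∧ ∑ o, E o = 1

/-- A (bipartite, pure) quantum state: a unit vector in `ℂ ^ dA ⊗ ℂ ^ dB`, whose coordinates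
are indexed by `Fin dA × Fin dB`. -/
def IsState {dA dB : ℕ} (ψ : Fin dA × Fin dB → ℂ) : Prop :=
  star ψ ⬝ᵥ ψ = 1

/-- The probability `ψ* (E ⊗ F) ψ` that the measurement operators `E` on the first part and `F`
on the second part of the shared state `ψ` occur jointly. -/
def jointProb {dA dB : ℕ} (ψ : Fin dA × Fin dB → ℂ) (E : Matrix (Fin dA) (Fin dA) ℂ)
    (F : Matrix (Fin dB) (Fin dB) ℂ) : ℂ :=
  star ψ ⬝ᵥ (Matrix.mulVec (E ⊗ₖ F) ψ)

/-- There is a quantum homomorphism from `X` to `Y`: two players who share a finite-dimensional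
entangled state `ψ` can win the `(X, Y)`-homomorphism game with probability one. On input `x`
Alice measures the POVM `E x` and Bob the POVM `F x`; on equal inputs the outputs must be equal,
on adjacent inputs the outputs must be adjacent. -/
def QuantumHom {V W : Type*} [Fintype W] (X : SimpleGraph V) (Y : SimpleGraph W) : Prop :=
  ∃ (dA dB : ℕ) (ψ : Fin dA × Fin dB → ℂ)
    (E : V → W → Matrix (Fin dA) (Fin dA) ℂ) (F : V → W → Matrix (Fin dB) (Fin dB) ℂ),
    IsState ψ ∧ (∀ x, IsPOVM (E x)) ∧ (∀ x, IsPOVM (F x)) ∧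
    (∀ x y y', y ≠ y' → jointProb ψ (E x y) (F x y') = 0) ∧
    (∀ x x' y y', X.Adj x x' → ¬ Y.Adj y y' → jointProb ψ (E x y) (F x' y') = 0)

/-- The homomorphic product `X ⋉ Y`. -/
def homProduct {V W : Type*} (X : SimpleGraph V) (Y : SimpleGraph W) : SimpleGraph (V × W) where
  Adj p q := p ≠ q ∧ (p.1 = q.1 ∨ (X.Adj p.1 q.1 ∧ ¬ Y.Adj p.2 q.2))
  symm := ⟨fun _ _ ⟨h, h'⟩ => ⟨h.symm, h'.imp Eq.symm
    fun ⟨h1, h2⟩ => ⟨h1.symm, fun h3 => h2 h3.symm⟩⟩⟩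
  loopless := ⟨fun _ h => h.1 rfl⟩

/-- A classical channel with inputs `Z` and outputs `O`: the probability of output `o` on
input `z` is `N z o`. -/
abbrev Channel (Z O : Type*) := Z → PMF O

/-- The confusability graph of a channel: two distinct inputs are adjacent if some output has
positive probability on both. -/
def confusabilityGraph {Z O : Type*} (N : Channel Z O) : SimpleGraph Z where
  Adj z z' := z ≠ z' ∧ ∃ o, 0 < N z o ∧ 0 < N z' o
  symm := ⟨fun _ _ ⟨h, o, h1, h2⟩ => ⟨h.symm, o, h2, h1⟩⟩
  loopless := ⟨fun _ h => h.1 rfl⟩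

/-- One use of `N` suffices to send one of `m` messages with zero probability of error. -/
def CanSend {Z O : Type*} (N : Channel Z O) (m : ℕ) : Prop :=
  ∃ (enc : Fin m → Z) (dec : O → Fin m), ∀ i o, 0 < N (enc i) o → dec o = i

/-- One use of `N` and a finite-dimensional shared entangled state `ψ` suffice to send one of
`m` messages with zero probability of error. To send message `i` Alice measures the POVM `E i`
on her part of `ψ` and feeds the outcome `z` into the channel; on channel output `o` Bob measures
the POVM `D o` on his part of `ψ`, and its outcome `j` is his guess of the message. -/
def CanSendEntangled {Z O : Type*} [Fintype Z] (N : Channel Z O) (m : ℕ) : Prop :=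
  ∃ (dA dB : ℕ) (ψ : Fin dA × Fin dB → ℂ)
    (E : Fin m → Z → Matrix (Fin dA) (Fin dA) ℂ) (D : O → Fin m → Matrix (Fin dB) (Fin dB) ℂ),
    IsState ψ ∧ (∀ i, IsPOVM (E i)) ∧ (∀ o, IsPOVM (D o)) ∧
    ∀ i z o, 0 < N z o → ∀ j, j ≠ i → jointProb ψ (E i z) (D o j) = 0

/-- The one-shot zero-error capacity of a channel: the largest number of messages that can be
sent without error by one use of it. -/
noncomputable def channelCapacity {Z O : Type*} (N : Channel Z O) : ℕ∞ :=
  ⨆ (m : ℕ) (_ : CanSend N m), (m : ℕ∞)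

/-- The entanglement-assisted one-shot zero-error capacity of a channel. -/
noncomputable def channelCapacityEntangled {Z O : Type*} [Fintype Z] (N : Channel Z O) : ℕ∞ :=
  ⨆ (m : ℕ) (_ : CanSendEntangled N m), (m : ℕ∞)

open Classical in
/-- The possible outputs of the canonical channel of `G` on input `v`: the edges at `v`, and
a loop at `v` if `v` is isolated. -/
noncomputable def canonicalOutputs {V : Type*} [Fintype V] (G : SimpleGraph V) (v : V) :
    Finset (Sym2 V) :=
  if (G.incidenceFinset v).Nonempty then G.incidenceFinset v else {s(v, v)}

theorem canonicalOutputs_nonempty {V : Type*} [Fintype V] (G : SimpleGraph V) (v : V) :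
    (canonicalOutputs G v).Nonempty := by
  classical
  unfold canonicalOutputs
  split_ifs with h
  · exact h
  · exact Finset.singleton_nonempty _

/-- The canonical channel with confusability graph `G`: input `v` yields an edge at `v`,
uniformly at random (and the loop at `v` if `v` is isolated). -/
noncomputable def canonicalChannel {V : Type*} [Fintype V] (G : SimpleGraph V) :
    Channel V (Sym2 V) :=
  fun v => PMF.uniformOfFinset (canonicalOutputs G v) (canonicalOutputs_nonempty G v)

theorem confusabilityGraph_canonicalChannel {V : Type*} [Fintype V] (G : SimpleGraph V) :
    confusabilityGraph (canonicalChannel G) = G := by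
  classical
  have key : ∀ v o, 0 < canonicalChannel G v o ↔ o ∈ canonicalOutputs G v := by
    intro v o
    rw [pos_iff_ne_zero, ← PMF.mem_support_iff, canonicalChannel,
      PMF.mem_support_uniformOfFinset_iff]
  have mem : ∀ v o, o ∈ canonicalOutputs G v → v ∈ o ∧ (o ∈ G.edgeSet ∨ o = s(v, v)) := by
    intro v o ho
    unfold canonicalOutputs at ho
    split_ifs at ho with h
    · rw [SimpleGraph.mem_incidenceFinset] at ho
      exact ⟨ho.2, Or.inl ho.1⟩
    · rw [Finset.mem_singleton] at ho
      subst ho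
      exact ⟨Sym2.mem_mk_left _ _, Or.inr rfl⟩
  have mem' : ∀ v o, o ∈ G.edgeSet → v ∈ o → o ∈ canonicalOutputs G v := by
    intro v o ho hv
    have h : o ∈ G.incidenceFinset v := by
      rw [SimpleGraph.mem_incidenceFinset]
      exact ⟨ho, hv⟩
    unfold canonicalOutputs
    rw [if_pos ⟨o, h⟩]
    exact h
  ext v w
  constructor
  · rintro ⟨hne, o, hv, hw⟩
    rw [key] at hv hw
    have h1 := mem v o hv
    have h2 := mem w o hw
    have h3 : o = s(v, w) := (Sym2.mem_and_mem_iff hne).1 ⟨h1.1, h2.1⟩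
    subst h3
    rcases h1.2 with h | h
    · exact h
    · exact absurd (by simpa using h : w = v) hne.symm
  · intro h
    refine ⟨h.ne, s(v, w), ?_, ?_⟩
    · rw [key]
      exact mem' _ _ h (Sym2.mem_mk_left _ _)
    · rw [key]
      exact mem' _ _ h (Sym2.mem_mk_right _ _)

/-- The one-shot zero-error capacity of a graph. -/
noncomputable def capacity {V : Type*} [Fintype V] (G : SimpleGraph V) : ℕ∞ :=
  channelCapacity (canonicalChannel G)

/-- The entanglement-assisted one-shot zero-error capacity of a graph. -/
noncomputable def capacityEntangled {V : Type*} [Fintype V] (G : SimpleGraph V) : ℕ∞ :=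
  channelCapacityEntangled (canonicalChannel G)

end QHom

namespace QHom

open scoped Kronecker ComplexOrder MatrixOrder
open Matrix

/-! ### Orthogonal positive semidefinite matrices: supports, ranks, discrimination -/

section LinearAlgebra

variable {m n ι : Type*} [Fintype m] [Fintype n] [Fintype ι]

/-! Write `ψ` as a matrix `M`. Alice's outcome `E` leaves Bob with the unnormalised state `M * Eᵀ *
Mᴴ`, and states that must be told apart without error are orthogonal. Upper bound: each fibre `{x} ×
W` is a clique, so the residual states of different messages, restricted to inputs over `x`, are
orthogonal with ranges inside that of `M`; their ranks sum to at most `rank M`. For one message the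
residuals over all `x` sum to `M * Mᴴ`, so their ranks sum to at least `rank M`. Counting both ways
bounds `m` by `|V|` (`canSendEntangled_le_card`). Attainment: to send `x`, Alice plays the game on
`x` and inputs `(x, y)`. Perfect play makes residuals at adjacent vertices orthogonal, and the
inputs compatible with an output form a clique, so Bob can identify the input
(`canSendEntangled_card`). Classically, `|V|` messages would give an independent transversal of the
fibres, which is a homomorphism (`canSend_lt_card`). -/

theorem posSemidef_mul_eq_zero_of_trace [DecidableEq n] {A B : Matrix n n ℂ}
    (hA : A.PosSemidef) (hB : B.PosSemidef) (h : (A * B).trace = 0) : A * B = 0 := by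
  obtain ⟨C, rfl⟩ := CStarAlgebra.nonneg_iff_eq_star_mul_self.1 (nonneg_iff_posSemidef.2 hA)
  obtain ⟨D, rfl⟩ := CStarAlgebra.nonneg_iff_eq_star_mul_self.1 (nonneg_iff_posSemidef.2 hB)
  simp only [star_eq_conjTranspose] at h ⊢
  have h1 : C * Dᴴ = 0 := by
    rw [← trace_conjTranspose_mul_self_eq_zero_iff, ← h, conjTranspose_mul,
      conjTranspose_conjTranspose, Matrix.mul_assoc, trace_mul_comm]
    simp only [Matrix.mul_assoc]
  calc Cᴴ * C * (Dᴴ * D) = Cᴴ * (C * Dᴴ) * D := by simp only [Matrix.mul_assoc]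
    _ = 0 := by rw [h1]; simp

/-- A Hermitian matrix `A` has a support projection, `A * B = B * A` for its pseudoinverse `B`. -/
theorem exists_supportProjection [DecidableEq n] {A : Matrix n n ℂ} (hA : A.IsHermitian) :
    ∃ B : Matrix n n ℂ, (A * B).IsHermitian ∧ A * B = B * A ∧ A * B * A = A ∧
      (A * B) * (A * B) = A * B := by
  let U : Matrix n n ℂ := hA.eigenvectorUnitary
  let D : Matrix n n ℂ := diagonal (fun i => (hA.eigenvalues i : ℂ))
  -- Since `0⁻¹ = 0`, this inverts only the nonzero eigenvalues.
  let D' : Matrix n n ℂ := diagonal (fun i => ((hA.eigenvalues i)⁻¹ : ℂ))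
  have hU : star U * U = 1 := Unitary.coe_star_mul_self hA.eigenvectorUnitary
  have hs : A = U * D * star U := by
    conv_lhs => rw [hA.spectral_theorem, Unitary.conjStarAlgAut_apply]
    rfl
  have conj_mul : ∀ S T : Matrix n n ℂ,
      (U * S * star U) * (U * T * star U) = U * (S * T) * star U := fun S T => by
    calc _ = U * S * (star U * U) * T * star U := by simp only [Matrix.mul_assoc]
      _ = _ := by rw [hU]; simp only [Matrix.mul_one, Matrix.mul_assoc]
  have hcomm : D * D' = D' * D := by
    simp only [D, D', diagonal_mul_diagonal, mul_comm]
  have hDD : D * D' * D = D := by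
    simp only [D, D', diagonal_mul_diagonal, mul_inv_mul_cancel]
  have hAB : A * (U * D' * star U) = U * (D * D') * star U := by rw [hs, conj_mul]
  refine ⟨U * D' * star U, ?_, ?_, ?_, ?_⟩
  · rw [hAB]
    simp only [IsHermitian, star_eq_conjTranspose, conjTranspose_mul, conjTranspose_conjTranspose,
      Matrix.mul_assoc, D, D', diagonal_conjTranspose]
    simp only [← Matrix.mul_assoc, diagonal_mul_diagonal]
    congr 2
    simp [mul_comm]
  · rw [hAB, hs, conj_mul, hcomm]
  · rw [hAB, hs, conj_mul, hDD]
  · rw [hAB, conj_mul, ← Matrix.mul_assoc (D * D'), hDD]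

/-- Pairwise orthogonal positive semidefinite matrices have pairwise orthogonal support
projections. -/
theorem exists_orthogonal_projections [DecidableEq n] {A : ι → Matrix n n ℂ}
    (hA : ∀ i, (A i).PosSemidef) (horth : ∀ i j, i ≠ j → A i * A j = 0) :
    ∃ B : ι → Matrix n n ℂ, (∀ i, (A i * B i).PosSemidef) ∧ (∀ i, A i * B i * A i = A i) ∧
      (∀ i j, i ≠ j → A i * B i * A j = 0) ∧
      (∑ i, A i * B i).IsHermitian ∧
      (∑ i, A i * B i) * (∑ i, A i * B i) = ∑ i, A i * B i ∧
      ∀ i, (A i * B i) * (A i * B i) = A i * B i := by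
  classical
  choose B hH hc hl hi using fun i => exists_supportProjection (hA i).1
  have ho : ∀ i j, i ≠ j → A i * B i * A j = 0 := fun i j hij => by
    rw [hc, Matrix.mul_assoc, horth i j hij, Matrix.mul_zero]
  refine ⟨B, fun i => ?_, hl, ho, ?_, ?_, hi⟩
  · rw [← hi i]
    nth_rw 1 [← (hH i).eq]
    exact posSemidef_conjTranspose_mul_self _
  · exact isSelfAdjoint_sum _ fun i _ => hH i
  · rw [Finset.sum_mul_sum]
    refine Finset.sum_congr rfl fun i _ => ?_
    rw [Finset.sum_eq_single i, hi]
    · intro j _ hj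
      rw [← Matrix.mul_assoc, ho i j hj.symm, Matrix.zero_mul]
    · simp

theorem rank_eq_trace_of_idempotent [DecidableEq n] {P : Matrix n n ℂ} (hP : P * P = P) :
    (P.rank : ℂ) = P.trace := by
  have h : LinearMap.IsProj (LinearMap.range P.toLin') P.toLin' := by
    refine ⟨fun x => ⟨x, rfl⟩, ?_⟩
    rintro _ ⟨y, rfl⟩
    rw [← LinearMap.comp_apply, ← toLin'_mul, hP]
  rw [← trace_toLin'_eq, h.trace]
  rfl

/-- The support projections add up to a projection. Rank equals trace for idempotents, so their
ranks add, and the sum factors through `M` on the left. -/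
theorem sum_rank_le_of_orthogonal {A : ι → Matrix n n ℂ} (hA : ∀ i, (A i).PosSemidef)
    (horth : ∀ i j, i ≠ j → A i * A j = 0) (M : Matrix n m ℂ) (C : ι → Matrix m n ℂ)
    (hC : ∀ i, A i = M * C i) : ∑ i, (A i).rank ≤ M.rank := by
  classical
  obtain ⟨B, -, hl, -, -, hQ, hP⟩ := exists_orthogonal_projections hA horth
  have h1 : ∑ i, (A i * B i).rank = (∑ i, A i * B i).rank := by
    have : ((∑ i, (A i * B i).rank : ℕ) : ℂ) = ((∑ i, A i * B i).rank : ℕ) := by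
      rw [rank_eq_trace_of_idempotent hQ, trace_sum, Nat.cast_sum]
      exact Finset.sum_congr rfl fun i _ => rank_eq_trace_of_idempotent (hP i)
    exact_mod_cast this
  calc ∑ i, (A i).rank ≤ ∑ i, (A i * B i).rank := Finset.sum_le_sum fun i _ => by
        conv_lhs => rw [← hl i]
        exact rank_mul_le_left _ _
    _ = (M * ∑ i, C i * B i).rank := by
        rw [h1, Matrix.mul_sum]
        simp only [← Matrix.mul_assoc, ← hC]
    _ ≤ M.rank := rank_mul_le_left _ _

theorem matrix_rank_add_le (A B : Matrix n n ℂ) : (A + B).rank ≤ A.rank + B.rank := by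
  have h := LinearMap.rank_add_le A.mulVecLin B.mulVecLin
  rw [← mulVecLin_add] at h
  simp only [LinearMap.rank, ← Module.finrank_eq_rank] at h
  exact_mod_cast h

theorem eq_zero_of_rank_eq_zero {l : Type*} {A : Matrix l n ℂ} (hA : A.rank = 0) : A = 0 := by
  classical
  rw [Matrix.rank, Submodule.finrank_eq_zero, LinearMap.range_eq_bot] at hA
  ext i j
  simpa using congrFun (LinearMap.congr_fun hA (Pi.single j 1)) i

theorem matrix_rank_sum_le {κ : Type*} (s : Finset κ) (A : κ → Matrix n n ℂ) :
    (∑ i ∈ s, A i).rank ≤ ∑ i ∈ s, (A i).rank := by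
  classical
  induction s using Finset.induction_on with
  | empty => simp
  | insert a s ha ih =>
    rw [Finset.sum_insert ha, Finset.sum_insert ha]
    exact (matrix_rank_add_le _ _).trans (Nat.add_le_add_left ih _)

/-- Pairwise orthogonal states can be told apart by a measurement. -/
theorem exists_povm_of_orthogonal {d : ℕ} [Nonempty ι] {A : ι → Matrix (Fin d) (Fin d) ℂ}
    (hA : ∀ i, (A i).PosSemidef) (horth : ∀ i j, i ≠ j → A i * A j = 0) :
    ∃ D : ι → Matrix (Fin d) (Fin d) ℂ, IsPOVM D ∧ ∀ i j, i ≠ j → D i * A j = 0 := by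
  classical
  obtain ⟨B, hP, hl, ho, hH, hQ, -⟩ := exists_orthogonal_projections hA horth
  obtain ⟨i₀⟩ := ‹Nonempty ι›
  set Q := ∑ i, A i * B i with hQdef
  have hR : (1 - Q).PosSemidef := by
    have h1 : (1 - Q)ᴴ * (1 - Q) = 1 - Q := by
      rw [conjTranspose_sub, conjTranspose_one, hH.eq, Matrix.mul_sub, Matrix.sub_mul,
        Matrix.sub_mul, hQ]
      simp
    rw [← h1]
    exact posSemidef_conjTranspose_mul_self _
  have hQA : ∀ j, Q * A j = A j := fun j => by
    rw [hQdef, Finset.sum_mul, Finset.sum_eq_single j, hl]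
    · exact fun i _ hij => ho i j hij
    · simp
  -- The defect `1 - Q` kills every `A j`, so it may be added to an arbitrary outcome `i₀`.
  refine ⟨fun i => A i * B i + if i = i₀ then 1 - Q else 0, ⟨fun i => ?_, ?_⟩, fun i j hij => ?_⟩
  · refine (hP i).add ?_
    split_ifs
    · exact hR
    · exact PosSemidef.zero
  · rw [Finset.sum_add_distrib, ← hQdef]
    simp
  · rw [Matrix.add_mul, ho i j hij]
    split_ifs
    · rw [Matrix.sub_mul, hQA]
      simp
    · simp

end LinearAlgebra

/-! ### Bob's states after Alice's measurement -/

section Residual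

variable {dA dB : ℕ}

/-- The state as a matrix whose columns are indexed by Alice's coordinates. -/
def stateMatrix (ψ : Fin dA × Fin dB → ℂ) : Matrix (Fin dB) (Fin dA) ℂ :=
  Matrix.of fun b a => ψ (a, b)

/-- The unnormalised state of the second part of `ψ` after the first was measured with
outcome `E`. -/
def residual (ψ : Fin dA × Fin dB → ℂ) (E : Matrix (Fin dA) (Fin dA) ℂ) :
    Matrix (Fin dB) (Fin dB) ℂ :=
  stateMatrix ψ * Eᵀ * (stateMatrix ψ)ᴴ

theorem jointProb_eq_trace (ψ : Fin dA × Fin dB → ℂ) (E : Matrix (Fin dA) (Fin dA) ℂ)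
    (F : Matrix (Fin dB) (Fin dB) ℂ) : jointProb ψ E F = (F * residual ψ E).trace := by
  have h : ψ = vec (stateMatrix ψ) := rfl
  rw [jointProb]
  conv_lhs => rw [h]
  rw [kronecker_mulVec_vec, star_vec_dotProduct_vec, trace_mul_comm, residual]
  simp only [Matrix.mul_assoc]

theorem residual_posSemidef (ψ : Fin dA × Fin dB → ℂ) {E : Matrix (Fin dA) (Fin dA) ℂ}
    (hE : E.PosSemidef) : (residual ψ E).PosSemidef :=
  hE.transpose.mul_mul_conjTranspose_same _

theorem residual_sum {ι : Type*} (s : Finset ι) (ψ : Fin dA × Fin dB → ℂ)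
    (E : ι → Matrix (Fin dA) (Fin dA) ℂ) :
    residual ψ (∑ i ∈ s, E i) = ∑ i ∈ s, residual ψ (E i) := by
  simp only [residual, transpose_sum, Matrix.mul_sum, Matrix.sum_mul]

theorem stateMatrix_ne_zero {ψ : Fin dA × Fin dB → ℂ} (hψ : IsState ψ) : stateMatrix ψ ≠ 0 := by
  intro h
  have h0 : ψ = 0 := by
    funext p
    exact congrFun (congrFun h p.2) p.1
  simp [IsState, h0] at hψ

theorem mul_residual_eq_zero {ψ : Fin dA × Fin dB → ℂ} {E : Matrix (Fin dA) (Fin dA) ℂ}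
    {F : Matrix (Fin dB) (Fin dB) ℂ} (hE : E.PosSemidef) (hF : F.PosSemidef)
    (h : jointProb ψ E F = 0) : F * residual ψ E = 0 :=
  posSemidef_mul_eq_zero_of_trace hF (residual_posSemidef ψ hE) (jointProb_eq_trace ψ E F ▸ h)

/-- States that a measurement tells apart without error are orthogonal. -/
theorem residual_mul_residual_eq_zero {O : Type*} [Fintype O] {ψ : Fin dA × Fin dB → ℂ}
    {E E' : Matrix (Fin dA) (Fin dA) ℂ} (hE : E.PosSemidef) (hE' : E'.PosSemidef)
    {D : O → Matrix (Fin dB) (Fin dB) ℂ} (hD : IsPOVM D) (i : O)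
    (h : jointProb ψ E (D i) = 0) (h' : ∀ j, j ≠ i → jointProb ψ E' (D j) = 0) :
    residual ψ E * residual ψ E' = 0 := by
  -- Outcome `i` is certain after `E'`, so `D i` fixes that state, whereas it annihilates the one
  -- left by `E`.
  have h1 : D i * residual ψ E' = residual ψ E' := by
    conv_rhs => rw [← Matrix.one_mul (residual ψ E'), ← hD.2, Finset.sum_mul]
    rw [Finset.sum_eq_single i]
    · exact fun j _ hj => mul_residual_eq_zero hE' (hD.1 j) (h' j hj)
    · simp
  have h2 : residual ψ E * D i = 0 := by
    have := congrArg conjTranspose (mul_residual_eq_zero hE (hD.1 i) h)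
    rwa [conjTranspose_mul, (hD.1 i).1.eq, (residual_posSemidef ψ hE).1.eq,
      conjTranspose_zero] at this
  rw [← h1, ← Matrix.mul_assoc, h2, Matrix.zero_mul]

end Residual

/-! ### Capacities of channels with confusability graph `X ⋉ Y` -/

section Capacity

variable {V W O : Type*} [Fintype V] {X : SimpleGraph V} {Y : SimpleGraph W}
  {N : Channel (V × W) O}

theorem canSend_lt_card (hc : ¬ Nonempty (X →g Y)) (hN : confusabilityGraph N = homProduct X Y)
    {m : ℕ} (hm : CanSend N m) : m < Fintype.card V := by
  obtain ⟨enc, dec, h⟩ := hm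
  have adj : ∀ i j, i ≠ j → enc i ≠ enc j → ¬ (homProduct X Y).Adj (enc i) (enc j) := by
    intro i j hij _ ha
    rw [← hN] at ha
    obtain ⟨-, o, h1, h2⟩ := ha
    exact hij ((h i o h1).symm.trans (h j o h2))
  have encinj : ∀ i j, i ≠ j → enc i ≠ enc j := by
    intro i j hij he
    obtain ⟨o, ho⟩ := (N (enc i)).support_nonempty
    have ho' : 0 < N (enc i) o := pos_iff_ne_zero.2 ho
    exact hij ((h i o ho').symm.trans (h j o (he ▸ ho')))
  have inj : Function.Injective fun i => (enc i).1 := by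
    intro i j hij
    by_contra hne
    exact adj i j hne (encinj i j hne) ⟨encinj i j hne, Or.inl hij⟩
  have hle : m ≤ Fintype.card V := by
    simpa using Fintype.card_le_of_injective _ inj
  -- With equality there is exactly one codeword over each `x`; its second coordinate is the image
  -- of `x`.
  refine lt_of_le_of_ne hle fun hcard => hc ?_
  have bij := (Fintype.bijective_iff_injective_and_card _).2 ⟨inj, by simpa using hcard⟩
  choose g hg using bij.2
  refine ⟨⟨fun x => (enc (g x)).2, fun {x x'} hx => ?_⟩⟩
  by_contra hY
  have hne : g x ≠ g x' := fun he => hx.ne (by rw [← hg x, ← hg x', he])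
  refine adj _ _ hne (encinj _ _ hne) ⟨encinj _ _ hne, Or.inr ⟨?_, hY⟩⟩
  have e1 : (enc (g x)).1 = x := hg x
  have e2 : (enc (g x')).1 = x' := hg x'
  rwa [e1, e2]

variable [Fintype W]

theorem canSendEntangled_le_card (hN : confusabilityGraph N = homProduct X Y) {m : ℕ}
    (hm : CanSendEntangled N m) : m ≤ Fintype.card V := by
  obtain ⟨dA, dB, ψ, E, D, hψ, hE, hD, h⟩ := hm
  have orth : ∀ x i j y y', i ≠ j →
      residual ψ (E i (x, y)) * residual ψ (E j (x, y')) = 0 := by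
    intro x i j y y' hij
    obtain ⟨o, h1, h2⟩ : ∃ o, 0 < N (x, y) o ∧ 0 < N (x, y') o := by
      by_cases hy : y = y'
      · obtain ⟨o, ho⟩ := (N (x, y)).support_nonempty
        have ho' : 0 < N (x, y) o := pos_iff_ne_zero.2 ho
        exact ⟨o, ho', hy ▸ ho'⟩
      · have hne : (x, y) ≠ (x, y') := fun he => hy (Prod.ext_iff.1 he).2
        have ha : (confusabilityGraph N).Adj (x, y) (x, y') := by
          rw [hN]
          exact ⟨hne, Or.inl rfl⟩
        exact ha.2
    exact residual_mul_residual_eq_zero ((hE i).1 _) ((hE j).1 _) (hD o) j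
      (h i _ o h1 j hij.symm) (h j _ o h2)
  let A : Fin m → V → Matrix (Fin dB) (Fin dB) ℂ := fun i x => residual ψ (∑ y, E i (x, y))
  have hA : ∀ i x, (A i x).PosSemidef := fun i x =>
    residual_posSemidef ψ (posSemidef_sum _ fun y _ => (hE i).1 _)
  have hAorth : ∀ x i j, i ≠ j → A i x * A j x = 0 := by
    intro x i j hij
    simp only [A, residual_sum, Finset.sum_mul_sum]
    exact Finset.sum_eq_zero fun y _ => Finset.sum_eq_zero fun y' _ => orth x i j y y' hij
  have upper : ∀ x, ∑ i, (A i x).rank ≤ (stateMatrix ψ).rank := fun x =>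
    sum_rank_le_of_orthogonal (fun i => hA i x) (hAorth x) _ _ fun i => Matrix.mul_assoc _ _ _
  have lower : ∀ i, (stateMatrix ψ).rank ≤ ∑ x, (A i x).rank := by
    intro i
    have hs : ∑ x, A i x = stateMatrix ψ * (stateMatrix ψ)ᴴ := by
      simp only [A]
      rw [← residual_sum, ← Fintype.sum_prod_type (fun z => E i z), (hE i).2, residual,
        transpose_one, Matrix.mul_one]
    rw [← rank_self_mul_conjTranspose, ← hs]
    exact matrix_rank_sum_le _ _
  -- A unit vector is nonzero, so the rank can be cancelled from the double count.
  have hpos : 0 < (stateMatrix ψ).rank :=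
    Nat.pos_of_ne_zero fun h0 => stateMatrix_ne_zero hψ (eq_zero_of_rank_eq_zero h0)
  refine Nat.le_of_mul_le_mul_right ?_ hpos
  calc m * (stateMatrix ψ).rank = ∑ _i : Fin m, (stateMatrix ψ).rank := by simp
    _ ≤ ∑ i, ∑ x, (A i x).rank := Finset.sum_le_sum fun i _ => lower i
    _ = ∑ x, ∑ i, (A i x).rank := Finset.sum_comm
    _ ≤ ∑ _x : V, (stateMatrix ψ).rank := Finset.sum_le_sum fun x _ => upper x
    _ = Fintype.card V * (stateMatrix ψ).rank := by simp

theorem canSendEntangled_card [Nonempty V] (hq : QuantumHom X Y)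
    (hN : confusabilityGraph N = homProduct X Y) :
    CanSendEntangled N (Fintype.card V) := by
  classical
  obtain ⟨dA, dB, ψ, E, F, hψ, hE, hF, hsame, hadj⟩ := hq
  -- The measurement built below needs an outcome in `V × W` to absorb its defect.
  have hW : Nonempty W := by
    by_contra hW
    rw [not_nonempty_iff] at hW
    obtain ⟨x⟩ := ‹Nonempty V›
    have h1 := (hE x).2
    rw [Fintype.sum_empty] at h1
    have h0 : stateMatrix ψ = 0 := by
      rw [← Matrix.mul_one (stateMatrix ψ), ← h1, Matrix.mul_zero]
    exact stateMatrix_ne_zero hψ h0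
  have orth : ∀ p q : V × W, (homProduct X Y).Adj p q →
      residual ψ (E p.1 p.2) * residual ψ (E q.1 q.2) = 0 := by
    rintro ⟨x, y⟩ ⟨x', y'⟩ ⟨hne, h⟩
    -- Bob's game measurement for `x'` does the separating: it yields `y'` surely after `(x', y')`
    -- and never after `(x, y)`.
    refine residual_mul_residual_eq_zero ((hE x).1 y) ((hE x').1 y') (hF x') y' ?_
      fun j hj => hsame x' y' j hj.symm
    rcases h with h | h
    · obtain rfl : x = x' := h
      exact hsame x y y' fun hy => hne (by rw [hy])
    · exact hadj x x' y y' h.1 h.2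
  have key : ∀ o, ∃ D : V × W → Matrix (Fin dB) (Fin dB) ℂ, IsPOVM D ∧
      ∀ p q, p ≠ q → 0 < N q o → D p * residual ψ (E q.1 q.2) = 0 := by
    intro o
    obtain ⟨D, hD, h⟩ := exists_povm_of_orthogonal
      -- Inputs that cannot produce `o` are zeroed out; the others are pairwise confusable.
      (A := fun p : V × W => if 0 < N p o then residual ψ (E p.1 p.2) else 0)
      (fun p => by
        split_ifs
        · exact residual_posSemidef ψ ((hE _).1 _)
        · exact PosSemidef.zero)
      (fun p q hpq => by
        split_ifs with h1 h2
        · have ha : (confusabilityGraph N).Adj p q := ⟨hpq, o, h1, h2⟩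
          exact orth p q (hN ▸ ha)
        all_goals simp)
    refine ⟨D, hD, fun p q hpq hq => ?_⟩
    simpa [hq] using h p q hpq
  choose D hD hDorth using key
  let e := (Fintype.equivFin V).symm
  -- Alice's operators vanish off the fibre of her message; Bob keeps only the fibre of the input he
  -- identifies.
  refine ⟨dA, dB, ψ, fun i z => if z.1 = e i then E z.1 z.2 else 0,
    fun o i => ∑ y, D o (e i, y), hψ, fun i => ⟨fun z => ?_, ?_⟩, fun o => ⟨fun i => ?_, ?_⟩, ?_⟩
  · dsimp only
    split_ifs
    · exact (hE _).1 _
    · exact PosSemidef.zero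
  · rw [Fintype.sum_prod_type, Finset.sum_eq_single (e i)]
    · simpa using (hE (e i)).2
    · intro x _ hx
      simp [hx]
    · simp
  · exact posSemidef_sum _ fun y _ => (hD o).1 _
  · rw [e.sum_comp fun x => ∑ y, D o (x, y), ← Fintype.sum_prod_type (D o)]
    exact (hD o).2
  · intro i z o hz j hji
    rw [jointProb_eq_trace]
    dsimp only
    split_ifs with hi
    · rw [Finset.sum_mul, Finset.sum_eq_zero, trace_zero]
      intro y _
      refine hDorth o _ _ (fun he => hji ?_) hz
      exact e.injective ((congrArg Prod.fst he).trans hi)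
    · simp [residual]

theorem channelCapacity_lt_entangled_eq_card (hq : QuantumHom X Y) (hc : ¬ Nonempty (X →g Y))
    (hN : confusabilityGraph N = homProduct X Y) :
    channelCapacity N < channelCapacityEntangled N ∧
      channelCapacityEntangled N = Fintype.card V := by
  -- An empty `X` maps to every graph. Nonemptiness makes `|V| - 1 < |V|` at the end.
  have hV : Nonempty V := by
    by_contra hV
    rw [not_nonempty_iff] at hV
    exact hc ⟨⟨fun x => hV.elim x, fun {x} => hV.elim x⟩⟩
  have heq : channelCapacityEntangled N = Fintype.card V :=
    le_antisymm (iSup₂_le fun m hm => by exact_mod_cast canSendEntangled_le_card hN hm)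
      (le_iSup₂ (f := fun (m : ℕ) (_ : CanSendEntangled N m) => (m : ℕ∞)) _
        (canSendEntangled_card hq hN))
  refine ⟨?_, heq⟩
  rw [heq]
  have hle : channelCapacity N ≤ ((Fintype.card V - 1 : ℕ) : ℕ∞) :=
    iSup₂_le fun m hm => by exact_mod_cast Nat.le_sub_one_of_lt (canSend_lt_card hc hN hm)
  refine hle.trans_lt ?_
  exact_mod_cast Nat.sub_lt Fintype.card_pos one_pos

end Capacity

end QHom

theorem mainTheorem12 {V W : Type*} [Fintype V] [Fintype W]
    (X : SimpleGraph V) (Y : SimpleGraph W)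
    (hq : QHom.QuantumHom X Y) (hc : ¬ Nonempty (X →g Y)) :
    (QHom.capacity (QHom.homProduct X Y) < QHom.capacityEntangled (QHom.homProduct X Y) ∧
      QHom.capacityEntangled (QHom.homProduct X Y) = Fintype.card V) ∧
    ∀ (O : Type*) (N : QHom.Channel (V × W) O),
      QHom.confusabilityGraph N = QHom.homProduct X Y →
        QHom.channelCapacity N < QHom.channelCapacityEntangled N ∧
          QHom.channelCapacityEntangled N = Fintype.card V :=
  ⟨QHom.channelCapacity_lt_entangled_eq_card hq hc
    (QHom.confusabilityGraph_canonicalChannel _),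
    fun _ _ hN => QHom.channelCapacity_lt_entangled_eq_card hq hc hN⟩
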